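/- Let $R$ be a commutative artinian ring and let $\Lambda$ be an Artin $R$-algebra, that is, an $R$-algebra which is finitely generated as an $R$-module. Let $\mathrm{mod}(\Lambda)$ be the category of finitely generated left $\Lambda$-modules. For $M\in\mathrm{mod}(\Lambda)$ fix a minimal projective resolution $\cdots\to P^{-1}(M)\xrightarrow{\pi^{-1}_M}P^0(M)\to M\to 0$ with syzygies $\Omega^i(M)$, where $\Omega^0(M)=M$. For a finitely generated projective left $\Lambda$-module $P$ put $\nu(P):=\mathrm{Hom}_R(\mathrm{Hom}_\Lambda(P,\Lambda),k)$, where $k$ is the injective envelope of $R/\mathrm{rad}(R)$. Put $\tau(M):=\mathrm{Ker}(\nu(\pi^{-1}_M))$ and $\tau_j(M):=\tau(\Omega^{j-1}(M))$ for $j\ge 1$. For a $\Lambda$-module $T$, a class $\mathcal{X}\subseteq\mathrm{mod}(\Lambda)$ and $i\geq 1$, define the following classes of modules in $\mathrm{mod}(\Lambda)$: $${}^{\perp_0}T:=\{N : \mathrm{Hom}_\Lambda(N,T)=0\},\qquad {}^{\perp_i}\mathcal{X}:=\{N : \mathrm{Ext}^i_\Lambda(N,X)=0\ \ \forall X\in\mathcal{X}\},$$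 $$M^{\perp_i}:=\{N : \mathrm{Ext}^i_\Lambda(M,N)=0\},\qquad M^{\perp}:=\bigcap_{i\ge1}M^{\perp_i},\qquad M^{\perp_{\tau_j}}:={}^{\perp_0}\tau_j(M)\cap\bigcap_{i=1}^{j-1}M^{\perp_i}.$$ Let $\mathrm{gen}(M)$ be the class of all quotients of finite direct sums of copies of $M$. A class of modules in $\mathrm{mod}(\Lambda)$ is called right thick if it is closed under extensions, cokernels of monomorphisms between its members, and direct summands. Then for every $M\in\mathrm{mod}(\Lambda)$ and every integer $j\ge1$ the following hold. (a) ${}^{\perp_0}\tau_j(M)\subseteq M^{\perp_j}$, and thus $M^{\perp_{\tau_j}}\subseteq\bigcap_{i=1}^{j}M^{\perp_i}$. (b) If $\mathrm{pd}(M)\le j$, then ${}^{\perp_0}\tau_j(M)=M^{\perp_j}$ and $M^{\perp_{\tau_j}}=M^{\perp}$. (c) For every $X\in\mathrm{mod}(\Lambda)$: $X\in{}^{\perp_j}\mathrm{gen}(M)$ if and only if $M\in{}^{\perp_0}\tau_j(X)$. (d) The class $M^{\perp_{\tau_j}}$ is right thick. -/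

import Mathlib

open CategoryTheory

universe u v

namespace TauPerp

noncomputable section

section Envelopes

variable {A : Type u} [Ring A]

/-- `N` is an essential submodule: it meets every nonzero submodule nontrivially. -/
def IsEssential {E : Type u} [AddCommGroup E] [Module A E] (N : Submodule A E) : Prop :=
  ∀ L : Submodule A E, L ⊓ N = ⊥ → L = ⊥

/-- `N` is a superfluous (small) submodule. -/
def IsSuperfluous {P : Type u} [AddCommGroup P] [Module A P] (N : Submodule A P) : Prop :=
  ∀ L : Submodule A P, L ⊔ N = ⊤ → L = ⊤

/-- `i : S → E` is an injective envelope of `S`. -/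
structure IsInjectiveEnvelope {S E : Type u} [AddCommGroup S] [Module A S]
    [AddCommGroup E] [Module A E] (i : S →ₗ[A] E) : Prop where
  injective_module : Module.Injective A E
  injective_map : Function.Injective i
  essential : IsEssential (LinearMap.range i)

/-- `p : P → M` is a projective cover of `M`. -/
structure IsProjectiveCover {P M : Type u} [AddCommGroup P] [Module A P]
    [AddCommGroup M] [Module A M] (p : P →ₗ[A] M) : Prop where
  projective_module : Module.Projective A P
  surjective_map : Function.Surjective p
  superfluous : IsSuperfluous (LinearMap.ker p)

/-- Every module has an injective envelope. -/
theorem exists_injectiveEnvelope (S : Type u) [AddCommGroup S] [Module A S] :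
    ∃ (E : ModuleCat.{u} A) (i : S →ₗ[A] E), IsInjectiveEnvelope i := by
  obtain ⟨J⟩ := (inferInstance : EnoughInjectives (ModuleCat.{u} A)).presentation
    (ModuleCat.of A S)
  obtain ⟨E, hE, f, hf⟩ := J
  have : CategoryTheory.Injective (ModuleCat.of A E) := hE
  have hEm : Module.Injective A E := Module.injective_module_of_injective_object A E
  have hfi : Function.Injective f.hom := (ModuleCat.mono_iff_injective f).1 hf
  set T : Submodule A E := LinearMap.range f.hom with hT
  -- `𝒮` consists of the submodules of `E` in which the image of `S` is essential
  let 𝒮 : Set (Submodule A E) := {N | T ≤ N ∧ ∀ L ≤ N, L ⊓ T = ⊥ → L = ⊥}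
  obtain ⟨N, hTN, hN⟩ : ∃ N, T ≤ N ∧ Maximal (· ∈ 𝒮) N := by
    refine zorn_le_nonempty₀ 𝒮 ?_ T ⟨le_rfl, fun L hL h => by rwa [inf_eq_left.2 hL] at h⟩
    intro c hc hchain y hy
    refine ⟨sSup c, ⟨(hc hy).1.trans (le_sSup hy), ?_⟩, fun z hz => le_sSup hz⟩
    intro L hL h
    rw [Submodule.eq_bot_iff]
    intro x hx
    obtain ⟨K, hK, hxK⟩ := (Submodule.mem_sSup_of_directed ⟨y, hy⟩ hchain.directedOn).1 (hL hx)
    have h1 : L ⊓ K = ⊥ := (hc hK).2 _ inf_le_right (by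
      rw [eq_bot_iff, ← h]
      exact inf_le_inf_right _ inf_le_left)
    have h2 : x ∈ L ⊓ K := ⟨hx, hxK⟩
    simpa [h1] using h2
  -- a complement of `N`
  obtain ⟨C, -, hC⟩ : ∃ C, ⊥ ≤ C ∧ Maximal (fun C : Submodule A E => C ⊓ N = ⊥) C := by
    refine zorn_le_nonempty₀ {C : Submodule A E | C ⊓ N = ⊥} ?_ ⊥ (bot_inf_eq N)
    intro c hc hchain y hy
    refine ⟨sSup c, ?_, fun z hz => le_sSup hz⟩
    change sSup c ⊓ N = ⊥
    rw [Submodule.eq_bot_iff]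
    rintro x ⟨hx, hxN⟩
    obtain ⟨K, hK, hxK⟩ := (Submodule.mem_sSup_of_directed ⟨y, hy⟩ hchain.directedOn).1 hx
    have h2 : x ∈ K ⊓ N := ⟨hxK, hxN⟩
    rw [show K ⊓ N = ⊥ from hc hK] at h2
    simpa using h2
  let q : N →ₗ[A] E ⧸ C := C.mkQ.comp N.subtype
  have hq : Function.Injective q := by
    rw [← LinearMap.ker_eq_bot, Submodule.eq_bot_iff]
    rintro ⟨x, hx⟩ h
    have hxC : x ∈ C := by simpa [q] using h
    have h2 : x ∈ C ⊓ N := ⟨hxC, hx⟩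
    rw [hC.prop] at h2
    ext
    simpa using h2
  obtain ⟨g, hg⟩ := hEm.out q hq N.subtype
  -- the map `g` is injective since `N` is essential in `E ⧸ C`
  have hgC : ∀ e : E, g (C.mkQ e) = 0 → e ∈ C := by
    intro e he
    have h1 : Submodule.comap C.mkQ (LinearMap.ker g) ⊓ N = ⊥ := by
      rw [Submodule.eq_bot_iff]
      rintro x ⟨hx, hxN⟩
      have := hg ⟨x, hxN⟩
      have h3 : g (C.mkQ x) = 0 := hx
      simpa [q] using this.symm.trans h3
    have h2 : C ≤ Submodule.comap C.mkQ (LinearMap.ker g) := by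
      intro x hx
      have : C.mkQ x = 0 := by simpa using hx
      change g (C.mkQ x) = 0
      rw [this, map_zero]
    exact hC.le_of_ge h1 h2 he
  have hNg : N ≤ LinearMap.range g := by
    intro x hx
    exact ⟨q ⟨x, hx⟩, hg ⟨x, hx⟩⟩
  have hgN : LinearMap.range g ≤ N := by
    refine hN.le_of_ge ⟨hN.prop.1.trans hNg, ?_⟩ hNg
    intro L hL h
    have h1 : L ⊓ N = ⊥ := hN.prop.2 _ inf_le_right (by
      rw [eq_bot_iff, ← h]
      exact inf_le_inf_right _ inf_le_left)
    have h2 : Submodule.comap (g.comp C.mkQ) L ⊓ N = ⊥ := by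
      rw [Submodule.eq_bot_iff]
      rintro x ⟨hx, hxN⟩
      have h3 : g (C.mkQ x) = x := hg ⟨x, hxN⟩
      have h4 : x ∈ L ⊓ N := ⟨by
        have : g (C.mkQ x) ∈ L := hx
        rwa [h3] at this, hxN⟩
      simpa [h1] using h4
    have h5 : C ≤ Submodule.comap (g.comp C.mkQ) L := by
      intro x hx
      have : C.mkQ x = 0 := by simpa using hx
      change g (C.mkQ x) ∈ L
      rw [this, map_zero]
      exact zero_mem _
    have h6 := hC.le_of_ge h2 h5
    rw [Submodule.eq_bot_iff]
    intro y hy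
    obtain ⟨z, rfl⟩ := hL hy
    obtain ⟨e, rfl⟩ := C.mkQ_surjective z
    have : e ∈ C := h6 hy
    have : C.mkQ e = 0 := by simpa using this
    rw [this, map_zero]
  -- hence `N` is a retract of `E`
  let r : E →ₗ[A] N := (g.comp C.mkQ).codRestrict N fun x => hgN ⟨_, rfl⟩
  have hr : ∀ x : N, r x = x := fun x => Subtype.ext (hg x)
  refine ⟨ModuleCat.of A N, f.hom.codRestrict N fun x => hN.prop.1 ⟨x, rfl⟩, ?_, ?_, ?_⟩
  · refine ⟨fun X Y _ _ _ _ a ha b => ?_⟩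
    obtain ⟨h, hh⟩ := hEm.out a ha (N.subtype.comp b)
    refine ⟨r.comp h, fun x => ?_⟩
    change r (h (a x)) = b x
    rw [hh]
    exact hr _
  · intro x y hxy
    exact hfi (congrArg Subtype.val hxy)
  · intro (L : Submodule A N) h
    have h1 : L.map N.subtype = ⊥ := by
      refine hN.prop.2 _ (Submodule.map_subtype_le _ _) ?_
      rw [Submodule.eq_bot_iff]
      rintro _ ⟨⟨x, hxL, rfl⟩, ⟨s, hs⟩⟩
      have h2 : x ∈ L ⊓ LinearMap.range (f.hom.codRestrict N fun x => hN.prop.1 ⟨x, rfl⟩) :=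
        ⟨hxL, ⟨s, Subtype.ext hs⟩⟩
      rw [h] at h2
      have h3 : x = 0 := h2
      simp [h3]
    exact Submodule.map_injective_of_injective N.injective_subtype (h1.trans (Submodule.map_bot _).symm)

/-- Every finitely generated module over an artinian ring has a finitely generated
projective cover. -/
theorem exists_projectiveCover [IsArtinianRing A] (M : FGModuleCat.{u} A) :
    ∃ (P : FGModuleCat.{u} A) (p : P →ₗ[A] M), IsProjectiveCover p := by
  obtain ⟨n, f, hf⟩ := Module.Finite.exists_fin' A M
  -- the direct summands of a free module that map onto `M`
  let 𝒮 : Set (Submodule A (Fin n → A)) :=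
    {Q | (∃ C, IsCompl Q C) ∧ Q.map f = ⊤}
  have h𝒮 : 𝒮.Nonempty := ⟨⊤, ⟨⊥, isCompl_top_bot⟩, by
    rw [Submodule.map_top]; exact LinearMap.range_eq_top.2 hf⟩
  obtain ⟨Q, ⟨⟨C, hQC⟩, hQ⟩, hmin⟩ := WellFounded.has_min
    (wellFounded_lt (α := Submodule A (Fin n → A))) 𝒮 h𝒮
  have hQp : Module.Projective A Q :=
    Module.Projective.of_split Q.subtype (Q.projectionOnto C hQC)
      (by ext x; simp)
  have hsurj : Function.Surjective (f.comp Q.subtype) := by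
    intro m
    have : m ∈ Q.map f := by rw [hQ]; trivial
    obtain ⟨x, hx, rfl⟩ := this
    exact ⟨⟨x, hx⟩, rfl⟩
  refine ⟨FGModuleCat.of A Q, f.comp Q.subtype, hQp, hsurj, ?_⟩
  intro (L : Submodule A Q) hL
  -- lift `Q → M` along the surjection `L → M`
  have hLs : Function.Surjective ((f.comp Q.subtype).comp L.subtype) := by
    intro m
    obtain ⟨x, rfl⟩ := hsurj m
    have hx : x ∈ L ⊔ LinearMap.ker (f.comp Q.subtype) := by rw [hL]; trivial
    obtain ⟨y, hy, z, hz, rfl⟩ := Submodule.mem_sup.1 hx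
    refine ⟨⟨y, hy⟩, ?_⟩
    have hz' : (f.comp Q.subtype) z = 0 := hz
    rw [map_add, hz', add_zero]
    rfl
  obtain ⟨g, hg⟩ := Module.projective_lifting_property _ (f.comp Q.subtype) hLs
  let e : Module.End A Q := L.subtype.comp g
  have he : ∀ x, f (e x : Fin n → A) = f x := fun x => LinearMap.congr_fun hg x
  have hek : ∀ k x, f ((e ^ k) x : Fin n → A) = f x := by
    intro k
    induction k with
    | zero => intro x; simp
    | succ k ih => intro x; rw [pow_succ', Module.End.mul_apply, he, ih]
  obtain ⟨k, hk1, hk⟩ := ((Filter.eventually_ge_atTop 1).and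
    (LinearMap.eventually_isCompl_ker_pow_range_pow e)).exists
  -- by minimality of `Q` the image of a power of `e` is everything
  have hmem : (LinearMap.range (e ^ k)).map Q.subtype ∈ 𝒮 := by
    refine ⟨⟨(LinearMap.ker (e ^ k)).map Q.subtype ⊔ C, ?_⟩, ?_⟩
    · constructor
      · rw [Submodule.disjoint_def]
        rintro _ ⟨x, hx, rfl⟩ h
        obtain ⟨_, ⟨y, hy, rfl⟩, c, hc, hyc⟩ := Submodule.mem_sup.1 h
        have hc0 : c = 0 := by
          have : c = ((x - y : Q) : Fin n → A) := by
            rw [Submodule.coe_sub]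
            exact eq_sub_of_add_eq' hyc
          exact Submodule.disjoint_def.1 hQC.disjoint c (this ▸ (x - y).2) hc
        rw [hc0, add_zero] at hyc
        have hxy : y = x := Subtype.ext hyc
        subst hxy
        have : y = 0 := Submodule.disjoint_def.1 hk.disjoint y hy hx
        simp [this]
      · rw [codisjoint_iff, ← sup_assoc, ← Submodule.map_sup, sup_comm (LinearMap.range _),
          hk.sup_eq_top, Submodule.map_top, Submodule.range_subtype, hQC.sup_eq_top]
    · rw [eq_top_iff]
      intro m _
      obtain ⟨x, rfl⟩ := hsurj m
      exact ⟨_, ⟨(e ^ k) x, ⟨x, rfl⟩, rfl⟩, hek k x⟩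
  have hrange : (LinearMap.range (e ^ k)).map Q.subtype = Q :=
    (Submodule.map_subtype_le _ _).eq_of_not_lt (hmin _ hmem)
  rw [eq_top_iff]
  intro x _
  have hx : (x : Fin n → A) ∈ (LinearMap.range (e ^ k)).map Q.subtype := by
    rw [hrange]; exact x.2
  obtain ⟨_, ⟨y, rfl⟩, hy⟩ := hx
  have hxy : x = (e ^ k) y := Subtype.ext hy.symm
  obtain ⟨k, rfl⟩ := Nat.exists_eq_add_of_le' hk1
  rw [hxy, pow_succ', Module.End.mul_apply]
  exact (g ((e ^ k) y)).2

end Envelopes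

section Resolutions

variable {A : Type u} [Ring A] [IsArtinianRing A]

/-- The fixed projective cover `P⁰(M)` of `M`. -/
def projCover (M : FGModuleCat.{u} A) : FGModuleCat.{u} A :=
  (exists_projectiveCover M).choose

/-- The augmentation `P⁰(M) → M`. -/
def projCoverMap (M : FGModuleCat.{u} A) : projCover M →ₗ[A] M :=
  (exists_projectiveCover M).choose_spec.choose

theorem projCoverMap_isProjectiveCover (M : FGModuleCat.{u} A) :
    IsProjectiveCover (projCoverMap M) :=
  (exists_projectiveCover M).choose_spec.choose_spec

/-- The syzygies: `Ω⁰(M) = M` and `Ωⁿ⁺¹(M)` is the kernel of the projective cover of `Ωⁿ(M)`. -/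
def syzygy : ℕ → FGModuleCat.{u} A → FGModuleCat.{u} A
  | 0, M => M
  | n + 1, M => FGModuleCat.of A (LinearMap.ker (projCoverMap (syzygy n M)))

/-- The term `P⁻ⁿ(M)` of the minimal projective resolution of `M`, obtained by splicing
projective covers of the syzygies. -/
def minRes (n : ℕ) (M : FGModuleCat.{u} A) : FGModuleCat.{u} A :=
  projCover (syzygy n M)

/-- The differential `P⁻⁽ⁿ⁺¹⁾(M) → P⁻ⁿ(M)` of the minimal projective resolution of `M`. -/
def minResMap (n : ℕ) (M : FGModuleCat.{u} A) : minRes (n + 1) M →ₗ[A] minRes n M :=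
  (LinearMap.ker (projCoverMap (syzygy n M))).subtype.comp (projCoverMap (syzygy (n + 1) M))

end Resolutions

section Nakayama

variable (R : Type v) [CommRing R]

/-- The injective envelope of `R / rad R`, as an `R`-module. -/
def dualizingModule : ModuleCat.{v} R :=
  (exists_injectiveEnvelope (A := R) (R ⧸ Ring.jacobson R)).choose

variable (Λ : Type u) [Ring Λ] [Algebra R Λ]

/-- For `a : Λ` the endomorphism `f ↦ (x ↦ f x * a)` of `P^* = Hom_Λ(P, Λ)`, that is, the right
action of `a` on `P^*`. -/
def dualMulRight (P : Type u) [AddCommGroup P] [Module Λ P] (a : Λ) :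
    (P →ₗ[Λ] Λ) →ₗ[R] (P →ₗ[Λ] Λ) where
  toFun f :=
    { toFun := fun x => f x * a
      map_add' := fun x y => by rw [map_add, add_mul]
      map_smul' := fun b x => by simp [mul_assoc] }
  map_add' f g := by ext x; simp [add_mul]
  map_smul' c f := by ext x; simp

@[simp] theorem dualMulRight_apply (P : Type u) [AddCommGroup P] [Module Λ P] (a : Λ)
    (f : P →ₗ[Λ] Λ) (x : P) : dualMulRight R Λ P a f x = f x * a := rfl

/-- `ν(P) = D(P^*) = Hom_R(Hom_Λ(P, Λ), k)`, where `k` is the injective envelope of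
`R / rad R`. -/
def Nakayama (P : Type u) [AddCommGroup P] [Module Λ P] : Type (max u v) :=
  (P →ₗ[Λ] Λ) →ₗ[R] dualizingModule R

instance (P : Type u) [AddCommGroup P] [Module Λ P] : AddCommGroup (Nakayama R Λ P) :=
  inferInstanceAs (AddCommGroup ((P →ₗ[Λ] Λ) →ₗ[R] dualizingModule R))

/-- The left `Λ`-module structure `(a • φ) f = φ (f a)` on `ν(P)`. -/
instance (P : Type u) [AddCommGroup P] [Module Λ P] : Module Λ (Nakayama R Λ P) where
  smul a φ := LinearMap.comp (φ : (P →ₗ[Λ] Λ) →ₗ[R] dualizingModule R) (dualMulRight R Λ P a)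
  one_smul φ := LinearMap.ext fun f => congrArg φ.toFun (by ext x; simp)
  mul_smul a b φ := LinearMap.ext fun f => congrArg φ.toFun (by ext x; simp [mul_assoc])
  smul_zero a := rfl
  smul_add a φ ψ := rfl
  add_smul a b φ := LinearMap.ext fun f =>
    (congrArg φ.toFun (show dualMulRight R Λ P (a + b) f
      = dualMulRight R Λ P a f + dualMulRight R Λ P b f by ext x; simp [mul_add])).trans
      (φ.map_add' _ _)
  zero_smul φ := LinearMap.ext fun f =>
    (congrArg φ.toFun (show dualMulRight R Λ P (0 : Λ) f = 0 by ext x; simp)).trans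
      (LinearMap.map_zero φ)

/-- The map `ν(f) : ν(P) → ν(Q)`, `φ ↦ (g ↦ φ (g ∘ f))`, induced by `f : P → Q`. -/
def nakayamaMap {P Q : Type u} [AddCommGroup P] [Module Λ P] [AddCommGroup Q] [Module Λ Q]
    (f : P →ₗ[Λ] Q) : Nakayama R Λ P →ₗ[Λ] Nakayama R Λ Q where
  toFun φ := LinearMap.comp (φ : (P →ₗ[Λ] Λ) →ₗ[R] dualizingModule R) (LinearMap.lcomp R Λ f)
  map_add' _ _ := rfl
  map_smul' _ _ := rfl

end Nakayama

section Tau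

variable (R : Type v) [CommRing R] [IsArtinianRing R]
variable {Λ : Type u} [Ring Λ] [Algebra R Λ] [Module.Finite R Λ]

/-- The Auslander–Reiten translate `τ(M) = Ker ν(P⁻¹(M) → P⁰(M))`. -/
def tau (M : FGModuleCat.{u} Λ) : ModuleCat.{max u v} Λ :=
  haveI : IsArtinianRing Λ := IsArtinianRing.of_finite R Λ
  ModuleCat.of Λ (LinearMap.ker (nakayamaMap R Λ (minResMap 0 M)))

/-- The `n`-Auslander–Reiten translate `τ_n(M) = τ(Ωⁿ⁻¹(M))`, for `n ≥ 1`. -/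
def tauN (n : ℕ) (M : FGModuleCat.{u} Λ) : ModuleCat.{max u v} Λ :=
  haveI : IsArtinianRing Λ := IsArtinianRing.of_finite R Λ
  tau R (syzygy (n - 1) M)

end Tau

section Classes

variable {Λ : Type u} [Ring Λ]

/-- The class `^{⊥₀}T` of the finitely generated `N` with `Hom_Λ(N, T) = 0`. -/
def homPerp (T : ModuleCat.{max u v} Λ) : Set (FGModuleCat.{u} Λ) :=
  {N | ∀ f : N →ₗ[Λ] T, f = 0}

/-- The class `𝒳^{⊥ᵢ}` of the `N` with `Ext^i_Λ(X, N) = 0` for all `X ∈ 𝒳`. -/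
def rightPerp (i : ℕ) (𝒳 : Set (FGModuleCat.{u} Λ)) : Set (FGModuleCat.{u} Λ) :=
  {N | ∀ X ∈ 𝒳, Subsingleton (Abelian.Ext.{u} X.obj N.obj i)}

/-- The class `^{⊥ᵢ}𝒳` of the `N` with `Ext^i_Λ(N, X) = 0` for all `X ∈ 𝒳`. -/
def leftPerp (i : ℕ) (𝒳 : Set (FGModuleCat.{u} Λ)) : Set (FGModuleCat.{u} Λ) :=
  {N | ∀ X ∈ 𝒳, Subsingleton (Abelian.Ext.{u} N.obj X.obj i)}

/-- The class `gen(M)` of the quotients of finite direct sums of copies of `M`. -/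
def gen (M : FGModuleCat.{u} Λ) : Set (FGModuleCat.{u} Λ) :=
  {X | ∃ (n : ℕ) (p : (Fin n → M) →ₗ[Λ] X), Function.Surjective p}

/-- A class of finitely generated modules is right thick if it is closed under extensions,
cokernels of monomorphisms between its members, and direct summands. -/
structure IsRightThick (𝒳 : Set (FGModuleCat.{u} Λ)) : Prop where
  extension : ∀ (A B C : FGModuleCat.{u} Λ) (f : A →ₗ[Λ] B) (g : B →ₗ[Λ] C),
    Function.Injective f → Function.Exact f g → Function.Surjective g →
      A ∈ 𝒳 → C ∈ 𝒳 → B ∈ 𝒳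
  mono_coker : ∀ (A B C : FGModuleCat.{u} Λ) (f : A →ₗ[Λ] B) (g : B →ₗ[Λ] C),
    Function.Injective f → Function.Exact f g → Function.Surjective g →
      A ∈ 𝒳 → B ∈ 𝒳 → C ∈ 𝒳
  summand : ∀ (A B C : FGModuleCat.{u} Λ) (_ : B ≃ₗ[Λ] A × C), B ∈ 𝒳 → A ∈ 𝒳

variable (R : Type v) [CommRing R] [IsArtinianRing R] [Algebra R Λ] [Module.Finite R Λ]

/-- The `τ_n`-perpendicular category
`𝒳^{⊥_{τ_n}} = ^{⊥₀}τ_n(𝒳) ∩ 𝒳^{⊥₁} ∩ ⋯ ∩ 𝒳^{⊥_{n-1}}`, for `n ≥ 1`. -/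
def tauPerp (n : ℕ) (𝒳 : Set (FGModuleCat.{u} Λ)) : Set (FGModuleCat.{u} Λ) :=
  (⋂ X ∈ 𝒳, homPerp.{u, v} (tauN R n X)) ∩ ⋂ i ∈ Set.Ico 1 n, rightPerp i 𝒳

end Classes

end

end TauPerp

open TauPerp

/-! Write `D` for `Hom_R(-, k)`. For `P` finitely generated projective, `Hom(N, ν P) ≅ D Hom(P, N)`
naturally in `P`. Since `k` is a cogenerator, `Hom(N, τ M) = 0` says exactly that every map `P⁻¹(M)
→ N` factors through `P⁻¹(M) → P⁰(M)` (`forall_to_ker_nakayamaMap_eq_zero_iff`). On the other hand,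
`Ext¹(M, N) = 0` says that every map `Ω(M) → N` extends to `P⁰(M)`. As `P⁻¹(M)` covers `Ω(M)`, the
first condition implies the second, and they agree when `Ω(M)` is projective. Dimension shifting to
`Ω^{j-1}(M)` gives (a) and (b).

For (c), `^{⊥₀}τ(X)` is closed under finite sums and quotients, so one direction follows from (a).
The converse is `IsProjectiveCover.exists_factorization`: extension for all quotients of `N` forces
factorization for `N` itself, because the cover has superfluous kernel. For (d), long exact
sequences suffice; cokernels also need `Ext^j(M, -)` to vanish, which is (a). -/

namespace TauPerp

/-! ### The injective envelope of `R / rad R` separates points. -/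

section Cogenerator

variable (R : Type v) [CommRing R] [IsArtinianRing R]

/-- The dualizing module is a cogenerator: nonzero elements of any module are detected by
linear maps to it. -/
theorem exists_linearMap_dualizingModule_ne_zero {V : Type*} [AddCommGroup V] [Module R V]
    {x : V} (hx : x ≠ 0) : ∃ θ : V →ₗ[R] dualizingModule R, θ x ≠ 0 := by
  obtain ⟨i, hi⟩ := (exists_injectiveEnvelope (A := R) (R ⧸ Ring.jacobson R)).choose_spec
  change (R ⧸ Ring.jacobson R) →ₗ[R] dualizingModule R at i
  have hinj : Module.Injective R (dualizingModule R) := hi.injective_module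
  -- `I` is the annihilator of `x`, so `R ⧸ I` is the cyclic module `R x`.
  let I : Ideal R := LinearMap.ker (LinearMap.toSpanSingleton R V x)
  have hI : I ≠ ⊤ := fun h => hx (by
    have : (1 : R) ∈ I := h ▸ Submodule.mem_top
    simpa [I] using this)
  obtain ⟨m, hm, hIm⟩ := Ideal.exists_le_maximal I hI
  have hJm : Ring.jacobson R ≤ m := Ring.jacobson_le_of_isMaximal m
  have hss : IsSemisimpleModule R (R ⧸ Ring.jacobson R) := by
    rw [IsArtinian.isSemisimpleModule_iff_jacobson]
    exact Module.jacobson_quotient_jacobson R R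
  -- Semisimplicity splits `R / rad R → R / m`, so the simple module `R / m` embeds in the envelope.
  obtain ⟨s, hs⟩ := IsSemisimpleModule.lifting_property (Submodule.factor hJm)
    (Submodule.factor_surjective hJm) LinearMap.id
  have hsi : Function.Injective s := Function.LeftInverse.injective (LinearMap.congr_fun hs)
  let ψ : R →ₗ[R] dualizingModule R := i ∘ₗ s ∘ₗ m.mkQ
  have hIψ : I ≤ LinearMap.ker ψ := fun r hr => by
    have : m.mkQ r = 0 := (Submodule.Quotient.mk_eq_zero m).2 (hIm hr)
    simp only [ψ, LinearMap.mem_ker, LinearMap.comp_apply, this, map_zero]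
  -- Extend `R x ≅ R / I → R / m → k` to all of `V` by injectivity.
  obtain ⟨θ, hθ⟩ := Module.Injective.extension_property R _ _ _
    (Submodule.liftQ I (LinearMap.toSpanSingleton R V x) le_rfl)
    (LinearMap.ker_eq_bot.1 (Submodule.ker_liftQ_eq_bot _ _ _ le_rfl)) (Submodule.liftQ I ψ hIψ)
  refine ⟨θ, fun h => hm.ne_top ((Ideal.eq_top_iff_one _).2 ?_)⟩
  have h1 : θ ((1 : R) • x) = ψ 1 := LinearMap.congr_fun hθ (I.mkQ 1)
  rw [one_smul, h] at h1
  have h2 : m.mkQ 1 = 0 := hsi (hi.injective_map (h1.symm.trans (by rw [map_zero]; exact (map_zero i).symm)))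
  exact (Submodule.Quotient.mk_eq_zero m).1 h2

end Cogenerator

/-- A finitely generated projective module has a finite dual basis. -/
theorem exists_dual_basis (Λ : Type u) [Ring Λ] (P : Type u) [AddCommGroup P] [Module Λ P]
    [Module.Finite Λ P] [Module.Projective Λ P] :
    ∃ (n : ℕ) (x : Fin n → P) (g : Fin n → P →ₗ[Λ] Λ), ∀ y, ∑ i, g i y • x i = y := by
  obtain ⟨n, f, g, -, -, hfg⟩ := Module.Finite.exists_comp_eq_id_of_projective Λ P
  refine ⟨n, fun i => f (Pi.single i 1), fun i => (LinearMap.proj i).comp g, fun y => ?_⟩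
  calc _ = f (∑ i, g y i • Pi.single i 1) := by simp
    _ = y := by
      rw [← pi_eq_sum_univ' (g y)]
      exact LinearMap.congr_fun hfg y

/-! ### The duality `D Hom(P, N) ≅ Hom(N, ν P)`. -/

section Duality

variable (R : Type v) [CommRing R] {Λ : Type u} [Ring Λ] [Algebra R Λ]
variable {N : Type u} [AddCommGroup N] [Module Λ N] [Module R N] [IsScalarTower R Λ N]
variable {P Q : Type u} [AddCommGroup P] [Module Λ P] [AddCommGroup Q] [Module Λ Q]

/-- The action of `Λ` on `ν(P)`, evaluated at an element of `P^*`. -/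
theorem Nakayama.smul_apply (a : Λ) (φ : Nakayama R Λ P)
    (g : P →ₗ[Λ] Λ) :
    (show (P →ₗ[Λ] Λ) →ₗ[R] dualizingModule R from a • φ) g =
      (show (P →ₗ[Λ] Λ) →ₗ[R] dualizingModule R from φ) (dualMulRight R Λ P a g) := rfl

/-- The comparison map `D Hom_Λ(P, N) → Hom_Λ(N, ν(P))`. -/
noncomputable def homNakayama (θ : (P →ₗ[Λ] N) →ₗ[R] dualizingModule R) :
    N →ₗ[Λ] Nakayama R Λ P where
  toFun n := θ ∘ₗ
    { toFun := fun g => (LinearMap.toSpanSingleton Λ N n).comp g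
      map_add' := fun g h => by ext x; simp [add_smul]
      map_smul' := fun r g => by ext x; simp }
  map_add' n m := LinearMap.ext fun g =>
    (congrArg θ (by ext x; simp)).trans (θ.map_add _ _)
  map_smul' a n := LinearMap.ext fun g => congrArg θ (by ext x; simp [mul_smul])

theorem homNakayama_apply (θ : (P →ₗ[Λ] N) →ₗ[R] dualizingModule R) (n : N) (g : P →ₗ[Λ] Λ) :
    (show (P →ₗ[Λ] Λ) →ₗ[R] dualizingModule R from homNakayama R θ n) g =
      θ ((LinearMap.toSpanSingleton Λ N n).comp g) := rfl

/-- Naturality in `P`: a functional vanishing on the maps that factor through `f` yields a map from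
`N` into `Ker ν(f)`. -/
theorem nakayamaMap_comp_homNakayama (f : P →ₗ[Λ] Q)
    (θ : (P →ₗ[Λ] N) →ₗ[R] dualizingModule R) :
    (nakayamaMap R Λ f).comp (homNakayama R θ) =
      homNakayama R (θ.comp (LinearMap.lcomp R N f)) := rfl

variable [Module.Finite Λ P] [Module.Projective Λ P]

/-- By the dual basis, the rank-one maps `y ↦ g y • n` generate `Hom(P, N)`, and `homNakayama R θ`
records the values of `θ` on them. -/
theorem homNakayama_injective :
    Function.Injective (homNakayama R : ((P →ₗ[Λ] N) →ₗ[R] dualizingModule R) → _) := by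
  obtain ⟨n, x, g, hxg⟩ := exists_dual_basis Λ P
  intro θ θ' h
  ext f
  have hf : f = ∑ i, (LinearMap.toSpanSingleton Λ N (f (x i))).comp (g i) := by
    ext y
    conv_lhs => rw [← hxg y]
    simp
  rw [hf, map_sum, map_sum]
  refine Finset.sum_congr rfl fun i _ => ?_
  rw [← homNakayama_apply, h, homNakayama_apply]

theorem homNakayama_surjective :
    Function.Surjective (homNakayama R : ((P →ₗ[Λ] N) →ₗ[R] dualizingModule R) → _) := by
  obtain ⟨n, x, g, hxg⟩ := exists_dual_basis Λ P
  intro φ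
  -- The only possible preimage: expand `f` as the sum of the maps `y ↦ g i y • f (x i)` and apply
  -- `φ` termwise.
  let θ : (P →ₗ[Λ] N) →ₗ[R] dualizingModule R :=
    { toFun := fun f =>
        ∑ i, (show (P →ₗ[Λ] Λ) →ₗ[R] dualizingModule R from φ (f (x i))) (g i)
      map_add' := fun f f' => by
        rw [← Finset.sum_add_distrib]
        refine Finset.sum_congr rfl fun i _ => ?_
        rw [LinearMap.add_apply, map_add]
        rfl
      map_smul' := fun r f => by
        rw [RingHom.id_apply, Finset.smul_sum]
        refine Finset.sum_congr rfl fun i _ => ?_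
        rw [LinearMap.smul_apply, ← algebraMap_smul Λ r (f (x i)), map_smul,
          Nakayama.smul_apply, ← LinearMap.map_smul]
        congr 1
        ext y
        simp [Algebra.smul_def, Algebra.commutes] }
  refine ⟨θ, ?_⟩
  refine LinearMap.ext fun m => LinearMap.ext fun h => ?_
  change ∑ i, (show (P →ₗ[Λ] Λ) →ₗ[R] dualizingModule R from φ (h (x i) • m)) (g i) = _
  have hh : h = ∑ i, dualMulRight R Λ P (h (x i)) (g i) := by
    ext y
    conv_lhs => rw [← hxg y]
    simp
  conv_rhs => rw [hh]
  refine Eq.trans ?_ (map_sum (show (P →ₗ[Λ] Λ) →ₗ[R] dualizingModule R from φ m) _ _).symm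
  refine Finset.sum_congr rfl fun i _ => ?_
  rw [map_smul, Nakayama.smul_apply]

end Duality

/-- For a map `f : P → Q` of finitely generated projectives, `Hom_Λ(N, Ker ν(f))` vanishes if and
only if every map `P → N` factors through `f`. -/
theorem forall_to_ker_nakayamaMap_eq_zero_iff (R : Type v) [CommRing R] [IsArtinianRing R]
    {Λ : Type u} [Ring Λ] [Algebra R Λ] {N : Type u} [AddCommGroup N] [Module Λ N]
    {P Q : Type u} [AddCommGroup P] [Module Λ P] [Module.Finite Λ P] [Module.Projective Λ P]
    [AddCommGroup Q] [Module Λ Q] [Module.Finite Λ Q] [Module.Projective Λ Q] (f : P →ₗ[Λ] Q) :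
    (∀ φ : N →ₗ[Λ] LinearMap.ker (nakayamaMap R Λ f), φ = 0) ↔
      ∀ h : P →ₗ[Λ] N, ∃ g : Q →ₗ[Λ] N, g.comp f = h := by
  -- Restriction of scalars supplies the `R`-structure needed for `D Hom(P, N)`; the statement does
  -- not depend on it.
  let _ : Module R N := Module.compHom N (algebraMap R Λ)
  have : IsScalarTower R Λ N := .of_algebraMap_smul fun _ _ => rfl
  constructor
  · intro H h
    by_contra hne
    -- A non-factoring `h` is nonzero in the cokernel of restriction along `f`, so some functional
    -- on that cokernel detects it.
    have hx : (LinearMap.range (LinearMap.lcomp R N f)).mkQ h ≠ 0 := fun h0 => hne (by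
      obtain ⟨g, hg⟩ : h ∈ LinearMap.range (LinearMap.lcomp R N f) := by simpa using h0
      exact ⟨g, hg⟩)
    obtain ⟨θ, hθ⟩ := exists_linearMap_dualizingModule_ne_zero R hx
    have h0 : (θ ∘ₗ (LinearMap.range (LinearMap.lcomp R N f)).mkQ) ∘ₗ
        LinearMap.lcomp R N f = 0 := by
      rw [LinearMap.comp_assoc, LinearMap.range_mkQ_comp, LinearMap.comp_zero]
    have h1 := nakayamaMap_comp_homNakayama R f
      (θ ∘ₗ (LinearMap.range (LinearMap.lcomp R N f)).mkQ)
    rw [h0] at h1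
    have h2 := H ((homNakayama R (θ ∘ₗ (LinearMap.range (LinearMap.lcomp R N f)).mkQ)).codRestrict
      _ fun n => LinearMap.congr_fun h1 n)
    have h3 : homNakayama R (θ ∘ₗ (LinearMap.range (LinearMap.lcomp R N f)).mkQ) =
        homNakayama R 0 :=
      LinearMap.ext fun n => congrArg Subtype.val (LinearMap.congr_fun h2 n)
    exact hθ (LinearMap.congr_fun (homNakayama_injective R h3) h)
  · intro H φ
    obtain ⟨θ, hθ⟩ := homNakayama_surjective R
      ((LinearMap.ker (nakayamaMap R Λ f)).subtype ∘ₗ φ)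
    have h1 := nakayamaMap_comp_homNakayama R f θ
    have h2 : (nakayamaMap R Λ f).comp (homNakayama R θ) = 0 := by
      rw [hθ]
      exact LinearMap.ext fun n => (φ n).2
    have h3 : θ.comp (LinearMap.lcomp R N f) = 0 :=
      homNakayama_injective R (h1.symm.trans h2)
    have h4 : θ = 0 := by
      ext h
      obtain ⟨g, rfl⟩ := H h
      exact LinearMap.congr_fun h3 g
    subst h4
    exact LinearMap.ext fun n => Subtype.ext (LinearMap.congr_fun hθ n).symm

end TauPerp

namespace TauPerp

/-! ### Vanishing of Ext along short exact sequences. -/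

section DimensionShift

variable {C : Type*} [Category* C] [Abelian C] [HasExt.{u} C]

theorem subsingleton_ext_of_shortExact_left {S : ShortComplex C} (hS : S.ShortExact) (N : C)
    (n : ℕ) (h₂ : Subsingleton (Abelian.Ext.{u} S.X₂ N (n + 1)))
    (h₁ : Subsingleton (Abelian.Ext.{u} S.X₁ N n)) :
    Subsingleton (Abelian.Ext.{u} S.X₃ N (n + 1)) := by
  refine subsingleton_of_forall_eq 0 fun x => ?_
  obtain ⟨y, rfl⟩ := Abelian.Ext.contravariant_sequence_exact₃ hS N x
    (Subsingleton.elim _ _) (add_comm 1 n)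
  rw [Subsingleton.elim y 0, Abelian.Ext.comp_zero]

theorem subsingleton_ext_succ_iff {S : ShortComplex C} (hS : S.ShortExact) [Projective S.X₂]
    (N : C) (n : ℕ) :
    Subsingleton (Abelian.Ext.{u} S.X₃ N (n + 2)) ↔
      Subsingleton (Abelian.Ext.{u} S.X₁ N (n + 1)) := by
  have h₂ (k : ℕ) : Subsingleton (Abelian.Ext.{u} S.X₂ N (k + 1)) :=
    HasProjectiveDimensionLT.subsingleton S.X₂ 1 _ (by lia) N
  refine ⟨fun _ => subsingleton_of_forall_eq 0 fun x => ?_,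
    subsingleton_ext_of_shortExact_left hS N (n + 1) (h₂ _)⟩
  obtain ⟨y, rfl⟩ := Abelian.Ext.contravariant_sequence_exact₁ hS N x (by lia : 1 + (n + 1) = n + 2)
    (Subsingleton.elim _ _)
  rw [Subsingleton.elim y 0, Abelian.Ext.comp_zero]

/-- With projective middle term, `Ext¹(X₃, N)` is the cokernel of `Hom(X₂, N) → Hom(X₁, N)`. -/
theorem subsingleton_ext_one_iff {S : ShortComplex C} (hS : S.ShortExact) [Projective S.X₂]
    (N : C) :
    Subsingleton (Abelian.Ext.{u} S.X₃ N 1) ↔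
      ∀ f : S.X₁ ⟶ N, ∃ g : S.X₂ ⟶ N, S.f ≫ g = f := by
  constructor
  · intro _ f
    obtain ⟨y, hy⟩ := Abelian.Ext.contravariant_sequence_exact₁ hS N (Abelian.Ext.mk₀ f)
      (by lia : 1 + 0 = 1) (Subsingleton.elim _ _)
    obtain ⟨g, rfl⟩ := (Abelian.Ext.mk₀_bijective _ _).2 y
    rw [Abelian.Ext.mk₀_comp_mk₀] at hy
    exact ⟨g, (Abelian.Ext.mk₀_bijective _ _).1 hy⟩
  · intro H
    have h₂ : Subsingleton (Abelian.Ext.{u} S.X₂ N 1) :=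
      HasProjectiveDimensionLT.subsingleton S.X₂ 1 _ le_rfl N
    refine subsingleton_of_forall_eq 0 fun x => ?_
    obtain ⟨y, rfl⟩ := Abelian.Ext.contravariant_sequence_exact₃ hS N x
      (Subsingleton.elim _ _) (by lia : 1 + 0 = 1)
    obtain ⟨f, rfl⟩ := (Abelian.Ext.mk₀_bijective _ _).2 y
    obtain ⟨g, rfl⟩ := H f
    rw [← Abelian.Ext.mk₀_comp_mk₀, hS.extClass_comp_assoc]

theorem subsingleton_ext_X₂ {S : ShortComplex C} (hS : S.ShortExact) (M : C) (n : ℕ)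
    (_ : Subsingleton (Abelian.Ext.{u} M S.X₁ n)) (_ : Subsingleton (Abelian.Ext.{u} M S.X₃ n)) :
    Subsingleton (Abelian.Ext.{u} M S.X₂ n) := by
  refine subsingleton_of_forall_eq 0 fun x => ?_
  obtain ⟨y, rfl⟩ := Abelian.Ext.covariant_sequence_exact₂ M hS x (Subsingleton.elim _ _)
  rw [Subsingleton.elim y 0, Abelian.Ext.zero_comp]

theorem subsingleton_ext_X₃ {S : ShortComplex C} (hS : S.ShortExact) (M : C) (n : ℕ)
    (_ : Subsingleton (Abelian.Ext.{u} M S.X₁ (n + 1)))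
    (_ : Subsingleton (Abelian.Ext.{u} M S.X₂ n)) :
    Subsingleton (Abelian.Ext.{u} M S.X₃ n) := by
  refine subsingleton_of_forall_eq 0 fun x => ?_
  obtain ⟨y, rfl⟩ := Abelian.Ext.covariant_sequence_exact₃ M hS x rfl (Subsingleton.elim _ _)
  rw [Subsingleton.elim y 0, Abelian.Ext.zero_comp]

theorem subsingleton_ext_of_retract (M : C) {X Y : C} (i : X ⟶ Y) (r : Y ⟶ X) (h : i ≫ r = 𝟙 X)
    (n : ℕ) (_ : Subsingleton (Abelian.Ext.{u} M Y n)) : Subsingleton (Abelian.Ext.{u} M X n) := by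
  refine subsingleton_of_forall_eq 0 fun x => ?_
  have h1 : (x.comp (Abelian.Ext.mk₀ i) (add_zero n)).comp (Abelian.Ext.mk₀ r) (add_zero n) = x := by
    simp [h]
  rw [← h1, Subsingleton.elim (x.comp _ _) 0, Abelian.Ext.zero_comp]

end DimensionShift

section LinearShortExact

variable {Λ : Type u} [Ring Λ]

/-- The short complex attached to an exact sequence of linear maps. -/
def linearShortComplex {A B C : FGModuleCat.{u} Λ} (f : A →ₗ[Λ] B) (g : B →ₗ[Λ] C)
    (h : Function.Exact f g) : ShortComplex (ModuleCat.{u} Λ) :=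
  ShortComplex.mk (X₁ := A.obj) (X₂ := B.obj) (X₃ := C.obj) (ModuleCat.ofHom f) (ModuleCat.ofHom g)
    (ModuleCat.hom_ext h.linearMap_comp_eq_zero)

theorem linearShortComplex_shortExact {A B C : FGModuleCat.{u} Λ} {f : A →ₗ[Λ] B}
    {g : B →ₗ[Λ] C} (hf : Function.Injective f) (h : Function.Exact f g)
    (hg : Function.Surjective g) : (linearShortComplex f g h).ShortExact where
  exact := (ShortComplex.ShortExact.moduleCat_exact_iff_function_exact _).2 h
  mono_f := (ModuleCat.mono_iff_injective _).2 hf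
  epi_g := (ModuleCat.epi_iff_surjective _).2 hg

end LinearShortExact

/-! ### Superfluous kernels and factorization through a projective cover. -/

section ProjectiveCovers

variable {Λ : Type u} [Ring Λ] {P M : Type u} [AddCommGroup P] [Module Λ P]
  [AddCommGroup M] [Module Λ M]

/-- A projective cover of a projective module is an isomorphism. -/
theorem IsProjectiveCover.injective {p : P →ₗ[Λ] M} (hp : IsProjectiveCover p)
    [Module.Projective Λ M] : Function.Injective p := by
  obtain ⟨s, hs⟩ := Module.projective_lifting_property p LinearMap.id hp.surjective_map
  have hps (y : M) : p (s y) = y := LinearMap.congr_fun hs y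
  -- Since `s` splits `p`, its range together with `ker p` spans `P`; superfluity then makes `s`
  -- onto.
  have htop : LinearMap.range s = ⊤ := hp.superfluous _ (by
    rw [eq_top_iff]
    intro x _
    exact Submodule.mem_sup.2 ⟨s (p x), ⟨_, rfl⟩, x - s (p x), by simp [hps], by simp⟩)
  refine (injective_iff_map_eq_zero p).2 fun x hx => ?_
  obtain ⟨y, rfl⟩ : x ∈ LinearMap.range s := htop ▸ Submodule.mem_top
  rw [← hps y, hx, map_zero]

/-- An endomorphism of a projective cover which is congruent to the identity modulo the kernel
is bijective. -/
theorem IsProjectiveCover.bijective_id_sub {p : P →ₗ[Λ] M} (hp : IsProjectiveCover p)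
    [IsNoetherian Λ P] (h : P →ₗ[Λ] LinearMap.ker p) :
    Function.Bijective (LinearMap.id - (LinearMap.ker p).subtype ∘ₗ h : P →ₗ[Λ] P) := by
  apply IsNoetherian.bijective_of_surjective_endomorphism
  rw [← LinearMap.range_eq_top]
  apply hp.superfluous
  rw [eq_top_iff]
  intro x _
  exact Submodule.mem_sup.2 ⟨_, ⟨x, rfl⟩, (h x : P), (h x).2, by simp⟩

/-- If `P → Ω` is a projective cover, `Ω ⊆ Q` with `Q` projective, and every map from `Ω` to a
quotient of `N` extends to `Q`, then every map `P → N` factors through `P → Q`. -/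
theorem IsProjectiveCover.exists_factorization {p : P →ₗ[Λ] M} (hp : IsProjectiveCover p)
    [IsNoetherian Λ P] {Q N : Type u} [AddCommGroup Q] [Module Λ Q] [Module.Projective Λ Q]
    [AddCommGroup N] [Module Λ N] (i : M →ₗ[Λ] Q)
    (H : ∀ (L : Submodule Λ N) (f : M →ₗ[Λ] N ⧸ L), ∃ g : Q →ₗ[Λ] N ⧸ L, g.comp i = f)
    (f : P →ₗ[Λ] N) : ∃ g : Q →ₗ[Λ] N, g ∘ₗ i ∘ₗ p = f := by
  have := hp.projective_module
  let K := LinearMap.ker p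
  -- Dividing `N` by `f(ker p)` is what makes `f` descend to `M`.
  let L := K.map f
  let e := p.quotKerEquivOfSurjective hp.surjective_map
  let f' : M →ₗ[Λ] N ⧸ L := (K.mapQ L f (Submodule.le_comap_map f K)) ∘ₗ e.symm
  have hf' (x : P) : f' (p x) = L.mkQ (f x) := by
    have : e.symm (p x) = K.mkQ x := by
      rw [LinearEquiv.symm_apply_eq]
      rfl
    simp [f', this]
  obtain ⟨g', hg'⟩ := H L f'
  obtain ⟨g, hg⟩ := Module.projective_lifting_property L.mkQ g' L.mkQ_surjective
  have hmem (x : P) : (f - g ∘ₗ i ∘ₗ p) x ∈ L := by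
    rw [← Submodule.Quotient.mk_eq_zero]
    have h1 : L.mkQ (g (i (p x))) = L.mkQ (f x) := by
      rw [← hf', ← hg']
      exact LinearMap.congr_fun hg _
    simpa [sub_eq_zero] using h1.symm
  -- The error `f - g i p` takes values in `f(K)`, so by projectivity it equals `f h` for some `h :
  -- P → K`.
  obtain ⟨h, hh⟩ := Module.projective_lifting_property (f.submoduleMap K)
    ((f - g ∘ₗ i ∘ₗ p).codRestrict L hmem) (f.submoduleMap_surjective K)
  have hfh (x : P) : f (h x) = f x - g (i (p x)) :=
    congrArg Subtype.val (LinearMap.congr_fun hh x)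
  refine ⟨g, LinearMap.ext fun y => ?_⟩
  -- Now `f (1 - h) = g i p = g i p (1 - h)`, since `p h = 0`; as `1 - h` is onto, it cancels.
  obtain ⟨x, rfl⟩ := (hp.bijective_id_sub h).2 y
  have hpx : p (h x : P) = 0 := (h x).2
  simp [hpx, hfh]

end ProjectiveCovers

/-! ### Ext and projective dimension of syzygies. -/

section Syzygies

variable {Λ : Type u} [Ring Λ] [IsArtinianRing Λ]

instance (M : FGModuleCat.{u} Λ) : Module.Projective Λ (projCover M) :=
  (projCoverMap_isProjectiveCover M).projective_module

/-- The short complex `Ω(M) → P⁰(M) → M`. -/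
noncomputable def syzygyComplex (M : FGModuleCat.{u} Λ) : ShortComplex (ModuleCat.{u} Λ) :=
  linearShortComplex (A := FGModuleCat.of Λ (LinearMap.ker (projCoverMap M)))
    (LinearMap.ker (projCoverMap M)).subtype (projCoverMap M)
    (LinearMap.exact_subtype_ker_map (projCoverMap M))

theorem syzygyComplex_shortExact (M : FGModuleCat.{u} Λ) : (syzygyComplex M).ShortExact :=
  linearShortComplex_shortExact (Submodule.injective_subtype _) _
    (projCoverMap_isProjectiveCover M).surjective_map

instance (M : FGModuleCat.{u} Λ) : Projective (syzygyComplex M).X₂ :=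
  (IsProjective.iff_projective (projCover M)).1 inferInstance

theorem subsingleton_ext_syzygy_iff (M : FGModuleCat.{u} Λ) (N : ModuleCat.{u} Λ) (n k : ℕ) :
    Subsingleton (Abelian.Ext.{u} M.obj N (n + k + 1)) ↔
      Subsingleton (Abelian.Ext.{u} (syzygy n M).obj N (k + 1)) := by
  induction n generalizing k with
  | zero => rw [zero_add]; rfl
  | succ n ih =>
    -- One unit moves from the syzygy index to the degree, which is why `k` is generalized.
    rw [add_right_comm n 1 k, add_assoc n k 1, ih (k + 1)]
    exact subsingleton_ext_succ_iff (syzygyComplex_shortExact (syzygy n M)) N k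

/-- The case `k = 0` is the one used: `pd M ≤ n` exactly when the `n`-th syzygy is projective. -/
theorem hasProjectiveDimensionLT_syzygy_iff (M : FGModuleCat.{u} Λ) (n k : ℕ) :
    HasProjectiveDimensionLT M.obj (n + k + 1) ↔
      HasProjectiveDimensionLT (syzygy n M).obj (k + 1) := by
  induction n generalizing k with
  | zero => rw [zero_add]; rfl
  | succ n ih =>
    rw [add_right_comm n 1 k, add_assoc n k 1, ih (k + 1)]
    exact (syzygyComplex_shortExact (syzygy n M)).hasProjectiveDimensionLT_X₃_iff k inferInstance

theorem subsingleton_ext_one_iff_extends (M N : FGModuleCat.{u} Λ) :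
    Subsingleton (Abelian.Ext.{u} M.obj N.obj 1) ↔
      ∀ f : syzygy 1 M →ₗ[Λ] N, ∃ g : projCover M →ₗ[Λ] N,
        g ∘ₗ (LinearMap.ker (projCoverMap M)).subtype = f := by
  refine (subsingleton_ext_one_iff (syzygyComplex_shortExact M) N.obj).trans ?_
  constructor
  · intro H f
    obtain ⟨g, hg⟩ := H (ModuleCat.ofHom f)
    exact ⟨g.hom, congrArg ModuleCat.Hom.hom hg⟩
  · intro H f
    obtain ⟨g, hg⟩ := H f.hom
    exact ⟨ModuleCat.ofHom g, ModuleCat.hom_ext hg⟩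

end Syzygies

/-! ### The four statements on perpendicular classes. -/

section Perpendicular

variable (R : Type v) [CommRing R] [IsArtinianRing R]
variable {Λ : Type u} [Ring Λ] [Algebra R Λ] [Module.Finite R Λ]

/-- The criterion on the right is free of `R`, `k` and `ν`; most later arguments about `τ` go
through it. -/
theorem mem_homPerp_tau_iff [IsArtinianRing Λ] (M N : FGModuleCat.{u} Λ) :
    N ∈ homPerp.{u, v} (tau R M) ↔
      ∀ h : minRes 1 M →ₗ[Λ] N, ∃ g : minRes 0 M →ₗ[Λ] N, g ∘ₗ minResMap 0 M = h :=
  haveI (n : ℕ) : Module.Projective Λ (minRes n M) :=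
    inferInstanceAs (Module.Projective Λ (projCover (syzygy n M)))
  forall_to_ker_nakayamaMap_eq_zero_iff R (minResMap 0 M)

/-- Precompose with the cover `P⁻¹ → Ω`, factor, and cancel that surjection. -/
theorem subsingleton_ext_one_of_mem_homPerp_tau {M N : FGModuleCat.{u} Λ}
    (h : N ∈ homPerp.{u, v} (tau R M)) : Subsingleton (Abelian.Ext.{u} M.obj N.obj 1) := by
  have : IsArtinianRing Λ := .of_finite R Λ
  rw [mem_homPerp_tau_iff] at h
  rw [subsingleton_ext_one_iff_extends]
  intro f
  obtain ⟨g, hg⟩ := h (f ∘ₗ projCoverMap (syzygy 1 M))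
  refine ⟨g, LinearMap.ext fun x => ?_⟩
  obtain ⟨y, rfl⟩ := (projCoverMap_isProjectiveCover (syzygy 1 M)).surjective_map x
  exact LinearMap.congr_fun hg y

theorem mem_homPerp_tau_of_subsingleton_ext_one [IsArtinianRing Λ] {M N : FGModuleCat.{u} Λ}
    (hM : Module.Projective Λ (syzygy 1 M)) (h : Subsingleton (Abelian.Ext.{u} M.obj N.obj 1)) :
    N ∈ homPerp.{u, v} (tau R M) := by
  rw [mem_homPerp_tau_iff]
  rw [subsingleton_ext_one_iff_extends] at h
  intro f
  have hp := projCoverMap_isProjectiveCover (syzygy 1 M)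
  let e : minRes 1 M ≃ₗ[Λ] syzygy 1 M := LinearEquiv.ofBijective _ ⟨hp.injective, hp.surjective_map⟩
  obtain ⟨g, hg⟩ := h (f ∘ₗ e.symm)
  refine ⟨g, LinearMap.ext fun x => ?_⟩
  exact (LinearMap.congr_fun hg (e x)).trans (congrArg f (e.symm_apply_apply x))

theorem gen_subset_homPerp_tau {M X : FGModuleCat.{u} Λ}
    (h : M ∈ homPerp.{u, v} (tau R X)) : gen M ⊆ homPerp.{u, v} (tau R X) := by
  rintro Q ⟨n, p, hp⟩ φ
  ext q
  obtain ⟨x, rfl⟩ := hp q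
  have h1 (i : Fin n) : φ ∘ₗ p ∘ₗ LinearMap.single Λ (fun _ => M) i = 0 := h _
  have h2 : φ ∘ₗ p = 0 := LinearMap.pi_ext' h1
  exact LinearMap.congr_fun h2 x

/-- Every quotient `M ⧸ L` lies in `gen M`, which is all that
`IsProjectiveCover.exists_factorization` asks for. -/
theorem mem_homPerp_tau_of_gen {M X : FGModuleCat.{u} Λ}
    (h : ∀ Q ∈ gen M, Subsingleton (Abelian.Ext.{u} X.obj Q.obj 1)) :
    M ∈ homPerp.{u, v} (tau R X) := by
  have : IsArtinianRing Λ := .of_finite R Λ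
  rw [mem_homPerp_tau_iff]
  refine (projCoverMap_isProjectiveCover (syzygy 1 X)).exists_factorization
    (Q := projCover X) (LinearMap.ker (projCoverMap X)).subtype fun L => ?_
  refine (subsingleton_ext_one_iff_extends X (FGModuleCat.of Λ (M ⧸ L))).1 (h _ ?_)
  exact ⟨1, L.mkQ ∘ₗ LinearMap.proj 0, L.mkQ_surjective.comp (LinearMap.proj_surjective 0)⟩

theorem mem_rightPerp_succ_iff [IsArtinianRing Λ] (M N : FGModuleCat.{u} Λ) (n : ℕ) :
    N ∈ rightPerp (n + 1) {M} ↔ Subsingleton (Abelian.Ext.{u} (syzygy n M).obj N.obj 1) := by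
  simp [rightPerp, ← subsingleton_ext_syzygy_iff]

theorem homPerp_tauN_subset_rightPerp (M : FGModuleCat.{u} Λ) {j : ℕ} (hj : 1 ≤ j) :
    homPerp.{u, v} (tauN R j M) ⊆ rightPerp j {M} := by
  have : IsArtinianRing Λ := .of_finite R Λ
  -- With `j = n + 1` the truncated `j - 1` in `tauN` becomes `n`.
  obtain ⟨n, rfl⟩ := Nat.exists_eq_add_of_le' hj
  exact fun N hN => (mem_rightPerp_succ_iff M N n).2 (subsingleton_ext_one_of_mem_homPerp_tau R hN)

theorem homPerp_tauN_eq_rightPerp (M : FGModuleCat.{u} Λ) {j : ℕ} (hj : 1 ≤ j)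
    (hM : HasProjectiveDimensionLE M.obj j) :
    homPerp.{u, v} (tauN R j M) = rightPerp j {M} := by
  have : IsArtinianRing Λ := .of_finite R Λ
  refine (homPerp_tauN_subset_rightPerp R M hj).antisymm fun N hN => ?_
  obtain ⟨n, rfl⟩ := Nat.exists_eq_add_of_le' hj
  have hproj : HasProjectiveDimensionLT (syzygy (n + 1) M).obj (0 + 1) :=
    (hasProjectiveDimensionLT_syzygy_iff M (n + 1) 0).1 hM
  have : Projective (syzygy (n + 1) M).obj :=
    projective_iff_hasProjectiveDimensionLT_one.2 hproj
  -- By definition `Ω^{n+1}(M)` is the first syzygy of `Ω^n(M)`.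
  exact mem_homPerp_tau_of_subsingleton_ext_one R
    ((IsProjective.iff_projective (syzygy (n + 1) M)).2 this) ((mem_rightPerp_succ_iff M N n).1 hN)

theorem mem_tauPerp_singleton_iff (M N : FGModuleCat.{u} Λ) (j : ℕ) :
    N ∈ tauPerp R j {M} ↔ N ∈ homPerp.{u, v} (tauN R j M) ∧
      ∀ i, 1 ≤ i → i < j → Subsingleton (Abelian.Ext.{u} M.obj N.obj i) := by
  simp [tauPerp, rightPerp]

theorem subsingleton_ext_of_mem_tauPerp {M N : FGModuleCat.{u} Λ} {j : ℕ}
    (h : N ∈ tauPerp R j {M}) {i : ℕ} (hi : 1 ≤ i) (hij : i ≤ j) :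
    Subsingleton (Abelian.Ext.{u} M.obj N.obj i) := by
  rw [mem_tauPerp_singleton_iff] at h
  obtain rfl | hlt := hij.eq_or_lt
  · exact homPerp_tauN_subset_rightPerp R M hi h.1 M rfl
  · exact h.2 i hi hlt

theorem tauPerp_eq_iInter_rightPerp (M : FGModuleCat.{u} Λ) {j : ℕ} (hj : 1 ≤ j)
    (hM : HasProjectiveDimensionLE M.obj j) :
    tauPerp R j {M} = ⋂ i ∈ Set.Ioi 0, rightPerp i {M} := by
  ext N
  simp only [Set.mem_iInter]
  constructor
  · rintro h i (hi : 0 < i) _ rfl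
    obtain hij | hij := le_or_gt i j
    · exact subsingleton_ext_of_mem_tauPerp R h hi hij
    · exact HasProjectiveDimensionLT.subsingleton _ (j + 1) i hij _
  · intro h
    rw [mem_tauPerp_singleton_iff, homPerp_tauN_eq_rightPerp R M hj hM]
    exact ⟨h j hj, fun i hi _ => h i hi M rfl⟩

theorem mem_leftPerp_gen_iff (M X : FGModuleCat.{u} Λ) {j : ℕ} (hj : 1 ≤ j) :
    X ∈ leftPerp j (gen M) ↔ M ∈ homPerp.{u, v} (tauN R j X) := by
  have : IsArtinianRing Λ := .of_finite R Λ
  obtain ⟨n, rfl⟩ := Nat.exists_eq_add_of_le' hj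
  constructor
  · exact fun h => mem_homPerp_tau_of_gen R fun Q hQ =>
      (subsingleton_ext_syzygy_iff X Q.obj n 0).1 (h Q hQ)
  · exact fun h Q hQ => (subsingleton_ext_syzygy_iff X Q.obj n 0).2
      (subsingleton_ext_one_of_mem_homPerp_tau R (gen_subset_homPerp_tau R h hQ))

theorem isRightThick_tauPerp (M : FGModuleCat.{u} Λ) (j : ℕ) :
    IsRightThick (tauPerp R j {M}) where
  extension A B C f g hf hfg hg hA hC := by
    rw [mem_tauPerp_singleton_iff] at hA hC ⊢
    refine ⟨fun φ => ?_, fun i hi hij =>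
      subsingleton_ext_X₂ (linearShortComplex_shortExact hf hfg hg) M.obj i (hA.2 i hi hij)
        (hC.2 i hi hij)⟩
    -- `φ` vanishes on `A`, hence factors through `C`, where it must vanish too.
    have hφ : φ ∘ₗ f = 0 := hA.1 _
    obtain ⟨ψ, rfl⟩ : ∃ ψ, ψ ∘ₗ g = φ := by
      refine ⟨(LinearMap.ker g).liftQ φ (fun x hx => ?_) ∘ₗ
        (g.quotKerEquivOfSurjective hg).symm, LinearMap.ext fun x => ?_⟩
      · obtain ⟨a, rfl⟩ := (hfg x).1 hx
        exact LinearMap.congr_fun hφ a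
      · have : (g.quotKerEquivOfSurjective hg).symm (g x) = (LinearMap.ker g).mkQ x := by
          rw [LinearEquiv.symm_apply_eq]
          rfl
        simp [this]
    rw [hC.1 ψ, LinearMap.zero_comp]
  mono_coker A B C f g hf hfg hg hA hB := by
    -- The cokernel needs `Ext^{i+1}(M, A) = 0` for `i < j`; the top degree `j` comes from
    -- `^{⊥₀}τ_j(M) ⊆ M^{⊥_j}`.
    have hA' := @subsingleton_ext_of_mem_tauPerp R _ _ _ _ _ _ _ _ _ hA
    rw [mem_tauPerp_singleton_iff] at hB ⊢
    refine ⟨fun φ => LinearMap.ext fun c => ?_, fun i hi hij =>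
      subsingleton_ext_X₃ (linearShortComplex_shortExact hf hfg hg) M.obj i
        (hA' (by lia) (by lia)) (hB.2 i hi hij)⟩
    obtain ⟨b, rfl⟩ := hg c
    exact LinearMap.congr_fun (hB.1 (φ ∘ₗ g)) b
  summand A B C e hB := by
    rw [mem_tauPerp_singleton_iff] at hB ⊢
    let r : B →ₗ[Λ] A := LinearMap.fst Λ A C ∘ₗ e.toLinearMap
    let s : A →ₗ[Λ] B := e.symm.toLinearMap ∘ₗ LinearMap.inl Λ A C
    have hrs : r ∘ₗ s = LinearMap.id := LinearMap.ext fun x => by simp [r, s]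
    refine ⟨fun φ => ?_, fun i hi hij => subsingleton_ext_of_retract M.obj
      (ModuleCat.ofHom s) (ModuleCat.ofHom r) (ModuleCat.hom_ext hrs) i (hB.2 i hi hij)⟩
    rw [← φ.comp_id, ← hrs, ← LinearMap.comp_assoc, hB.1 (φ ∘ₗ r), LinearMap.zero_comp]

end Perpendicular

end TauPerp

theorem mainTheorem11 (R : Type v) [CommRing R] [IsArtinianRing R]
    (Λ : Type u) [Ring Λ] [Algebra R Λ] [Module.Finite R Λ]
    (M : FGModuleCat.{u} Λ) (j : ℕ) (hj : 1 ≤ j) :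
    (homPerp.{u, v} (tauN R j M) ⊆ rightPerp j {M} ∧
      tauPerp R j {M} ⊆ ⋂ i ∈ Set.Icc 1 j, rightPerp i {M}) ∧
    (projectiveDimension M.obj ≤ (j : ℕ∞) →
      homPerp.{u, v} (tauN R j M) = rightPerp j {M} ∧
      tauPerp R j {M} = ⋂ i ∈ Set.Ioi 0, rightPerp i {M}) ∧
    (∀ X : FGModuleCat.{u} Λ,
      X ∈ leftPerp j (gen M) ↔ M ∈ homPerp.{u, v} (tauN R j X)) ∧
    IsRightThick (tauPerp R j {M}) := by
  refine ⟨⟨homPerp_tauN_subset_rightPerp R M hj, fun N hN => ?_⟩, fun hM => ?_,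
    fun X => mem_leftPerp_gen_iff R M X hj, isRightThick_tauPerp R M j⟩
  · simp only [Set.mem_iInter]
    rintro i hi _ rfl
    exact subsingleton_ext_of_mem_tauPerp R hN hi.1 hi.2
  · have hM' : HasProjectiveDimensionLE M.obj j := (projectiveDimension_le_iff _ _).1 hM
    exact ⟨homPerp_tauN_eq_rightPerp R M hj hM', tauPerp_eq_iInter_rightPerp R M hj hM'⟩
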